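/- All vector spaces are over $\mathbb C$, and for a vector space $W$ let $W((x_1,x_2))=W[[x_1,x_2]][x_1^{-1},x_2^{-1}]$. For $g(x)\in\mathbb C((x))$, $g(x_2-x_1)$ is expanded in nonnegative powers of $x_1$; $\iota_{x_2,x_1}$ denotes expansion in $\mathbb C((x_2))((x_1))$; $(x_i-x_j)^n$ is expanded in nonnegative powers of the second variable; and $\delta(x)=\sum_{n\in\mathbb Z}x^n$. A *weak quantum vertex algebra* is a vector space $V$ with a vector $\mathbf 1\in V$ and a linear map $Y(\cdot,x):V\to \mathrm{Hom}(V,V((x)))$, $Y(v,x)=\sum_{n\in\mathbb Z} v_nx^{-n-1}$, such that $Y(\mathbf 1,x)v=v$, $Y(v,x)\mathbf 1\in V[[x]]$ and $\lim_{x\to0}Y(v,x)\mathbf 1=v$ for all $v\in V$, and such that for all $u,v\in V$ there are finitely many $u^{(i)},v^{(i)}\in V$, $f_i\in\mathbb C((x))$ with $$x_0^{-1}\delta\Big(\frac{x_1-x_2}{x_0}\Big)Y(u,x_1)Y(v,x_2)-x_0^{-1}\delta\Big(\frac{x_2-x_1}{-x_0}\Big)\sum_i f_i(x_2-x_1)Y(v^{(i)},x_2)Y(u^{(i)},x_1)=x_2^{-1}\delta\Big(\frac{x_1-x_0}{x_2}\Big)Y(Y(u,x_0)v,x_2).$$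 It is of *T-type* if for all $u,v\in V$ there are $k\in\mathbb N$ and finitely many $u^{(i)},v^{(i)}\in V$, $f_i\in\mathbb C(x)$ with $$(x_1-x_2)^kY(u,x_1)Y(v,x_2)=(x_1-x_2)^k\sum_i\iota_{x_2,x_1}\big(f_i(e^{x_1-x_2})\big)Y(v^{(i)},x_2)Y(u^{(i)},x_1).$$ An *automorphism* of $V$ is a bijective linear map $\sigma$ with $\sigma(\mathbf 1)=\mathbf 1$ and $\sigma(Y(u,x)v)=Y(\sigma u,x)\sigma v$ for all $u,v\in V$. A *$\phi$-coordinated quasi $V$-module* (with $\phi(x,z)=xe^z$) is a vector space $W$ with a linear map $Y_W(\cdot,x):V\to\mathrm{Hom}(W,W((x)))$ such that $Y_W(\mathbf 1,x)=1_W$ and for all $u,v\in V$ there is a nonzero polynomial $p$ with $p(x_1/x_2)Y_W(u,x_1)Y_W(v,x_2)\in\mathrm{Hom}(W,W((x_1,x_2)))$ and $$p(e^z)Y_W(Y(u,z)v,x_2)=\big(p(x_1/x_2)Y_W(u,x_1)Y_W(v,x_2)\big)\big|_{x_1=x_2e^z}.$$ Let $G$ be a group acting on $V$ by automorphisms and let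 $\chi:G\to\mathbb C^\times$ be a homomorphism. Then $W$ is *$G$-covariant* if $Y_W(gv,x)=Y_W(v,\chi(g)x)$ for all $g\in G$, $v\in V$, and if for all $u,v\in V$ there is a nonzero polynomial $p$, all of whose zeros lie in $\chi(G)$, with $p(x_1/x_2)Y_W(u,x_1)Y_W(v,x_2)\in\mathrm{Hom}(W,W((x_1,x_2)))$. **Corollary.** Let $V$ be a T-type weak quantum vertex algebra, let $G$ and $\chi$ be as above, let $(W,Y_W)$ be a $G$-covariant $\phi$-coordinated quasi $V$-module, and let $u,v\in V$. Let $T$ be the set of all $\sigma\in G$ for which there is an integer $k_\sigma\ge1$ with $$(\sigma u)_{k_\sigma-1}v\ne0\quad\text{and}\quad(\sigma u)_nv=0\ \text{ for all } n\ge k_\sigma .$$ Then there is a finite set $\Lambda\subset\chi(G)$ with $\chi^{-1}(\Lambda)\subset T$ such that, for every finite set $S\subset T$ with $\Lambda\subset\chi(S)$, $$p(x_1/x_2)Y_W(u,x_1)Y_W(v,x_2)\in\mathrm{Hom}(W,W((x_1,x_2))),\qquad\text{where } p(x)=\prod_{\sigma\in S}(x-\chi(\sigma))^{k_\sigma}.$$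 (In particular, $S$ can be obtained by choosing any one $\sigma$ over each element of $\Lambda$; and if $T$ is finite, one can take $S=T$.) -/

import Mathlib

open HVertexOperator

noncomputable section

namespace QVA

/-! Formal calculus. A two-variable formal series `A(x₁, x₂) = ∑ A m n x₁ᵐ x₂ⁿ` in
`M[[x₁^{±1}, x₂^{±1}]]` is its family of coefficients; similarly in three variables
`x₀, x₁, x₂` (in this order). The space `𝓔(W) = Hom(W, W((x)))` is Mathlib's
`VertexOperator ℂ W`, and `coeff a n : W →ₗ[ℂ] W` is the coefficient of `xⁿ` in `a(x)`. -/

/-- Formal series in `x₁^{±1}, x₂^{±1}`: `A m n` is the coefficient of `x₁ᵐ x₂ⁿ`. -/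
abbrev Series2 (M : Type*) := ℤ → ℤ → M

/-- Formal series in `x₀^{±1}, x₁^{±1}, x₂^{±1}`: `A l m n` is the coefficient of
`x₀ˡ x₁ᵐ x₂ⁿ`. -/
abbrev Series3 (M : Type*) := ℤ → ℤ → ℤ → M

section Calculus

variable {M : Type*} [AddCommGroup M] [Module ℂ M]

/-- The product of a scalar series and a vector-valued series. It is used only where each
coefficient of the product is a finite sum. -/
def mul2 (f : Series2 ℂ) (A : Series2 M) : Series2 M :=
  fun m n => ∑ᶠ p : ℤ × ℤ, f p.1 p.2 • A (m - p.1) (n - p.2)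

/-- The same product in three variables. -/
def mul3 (f : Series3 ℂ) (A : Series3 M) : Series3 M :=
  fun l m n => ∑ᶠ p : ℤ × ℤ × ℤ, f p.1 p.2.1 p.2.2 • A (l - p.1) (m - p.2.1) (n - p.2.2)

/-- A series in `x₁, x₂` as a series in `x₀, x₁, x₂`. -/
def inX1X2 (A : Series2 M) : Series3 M := fun l m n => if l = 0 then A m n else 0

/-- A series in `x₀, x₂` (in this order) as a series in `x₀, x₁, x₂`. -/
def inX0X2 (A : Series2 M) : Series3 M := fun l m n => if m = 0 then A l n else 0

/-- `(x - y)ⁿ = ∑_{i ≥ 0} (n choose i) (-1)ⁱ x^{n-i} yⁱ` for `n ∈ ℤ`;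
`subPow n p q` is the coefficient of `xᵖ y^q`. -/
def subPow (n p q : ℤ) : ℂ :=
  if 0 ≤ q ∧ p + q = n then (-1) ^ q.toNat * ((Ring.choose n q.toNat : ℤ) : ℂ) else 0

/-- `(x₁ - x₂)ⁿ`, expanded in nonnegative powers of `x₂`. -/
def subPow12 (n : ℤ) : Series2 ℂ := fun p q => subPow n p q

/-- `x₀⁻¹ δ((x₁ - x₂)/x₀) = ∑_n x₀^{-n-1} (x₁ - x₂)ⁿ`. -/
def delta1 : Series3 ℂ := fun l p q => subPow (-l - 1) p q

/-- `x₀⁻¹ δ((x₂ - x₁)/(-x₀)) = ∑_n (-1)ⁿ x₀^{-n-1} (x₂ - x₁)ⁿ`. -/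
def delta2 : Series3 ℂ := fun l p q => (-1) ^ (-l - 1) * subPow (-l - 1) q p

/-- `x₂⁻¹ δ((x₁ - x₀)/x₂) = ∑_n x₂^{-n-1} (x₁ - x₀)ⁿ`. -/
def delta3 : Series3 ℂ := fun l p q => subPow (-q - 1) p l

/-- `g(x₂ - x₁) = ∑_n gₙ (x₂ - x₁)ⁿ` for `g(x) ∈ ℂ((x))`. -/
def evalX2SubX1 (g : LaurentSeries ℂ) : Series2 ℂ :=
  fun p q => g.coeff (p + q) * subPow (p + q) q p

/-- `ι_{x₂,x₁} g(x₁ - x₂) = ∑_n gₙ (-1)ⁿ (x₂ - x₁)ⁿ` for `g(x) ∈ ℂ((x))`. -/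
def evalX1SubX2 (g : LaurentSeries ℂ) : Series2 ℂ :=
  fun p q => g.coeff (p + q) * ((-1) ^ (p + q) * subPow (p + q) q p)

/-- `p(eˣ) ∈ ℂ[[x]]` for a polynomial `p`. -/
def polyExp (p : Polynomial ℂ) : PowerSeries ℂ := Polynomial.aeval (PowerSeries.exp ℂ) p

/-- `f(eˣ) ∈ ℂ((x))` for a rational function `f`. -/
def ratExp (f : RatFunc ℂ) : LaurentSeries ℂ :=
  (polyExp f.num : LaurentSeries ℂ) / (polyExp f.denom : LaurentSeries ℂ)

/-- `p(x₁/x₂) A(x₁, x₂)` for a polynomial `p`. -/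
def mulRatio (p : Polynomial ℂ) (A : Series2 M) : Series2 M :=
  fun m n => p.sum fun k c => c • A (m - k) (n + k)

end Calculus

section Fields

variable {W : Type*} [AddCommGroup W] [Module ℂ W]

/-- `a(x₁) b(x₂) ∈ (End W)[[x₁^{±1}, x₂^{±1}]]`. -/
def prod12 (a b : VertexOperator ℂ W) : Series2 (Module.End ℂ W) :=
  fun m n => coeff a m ∘ₗ coeff b n

/-- `b(x₂) a(x₁) ∈ (End W)[[x₁^{±1}, x₂^{±1}]]`. -/
def prod21 (b a : VertexOperator ℂ W) : Series2 (Module.End ℂ W) :=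
  fun m n => coeff b n ∘ₗ coeff a m

/-- `A(x₁, x₂) w`. -/
def applyTo (A : Series2 (Module.End ℂ W)) (w : W) : Series2 W := fun m n => A m n w

/-- `A(x₁, x₂) ∈ Hom(W, W((x₁, x₂)))`, where `W((x₁, x₂)) = W[[x₁, x₂]][x₁⁻¹, x₂⁻¹]`. -/
def InHomLaurent2 (A : Series2 (Module.End ℂ W)) : Prop :=
  ∀ w : W, ∃ N : ℤ, ∀ m n : ℤ, A m n w ≠ 0 → N ≤ m ∧ N ≤ n

/-- `A(x₁, x₂) w |_{x₁ = x₂ eᶻ}` for `A(x₁, x₂) ∈ Hom(W, W((x₁, x₂)))`, as a series in `z, x₂`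
(in this order): `x₁ᵐ x₂ⁿ` becomes `∑_{j ≥ 0} (mʲ / j!) zʲ x₂^{m+n}`. -/
def substExp (A : Series2 (Module.End ℂ W)) (w : W) : Series2 W :=
  fun j s => if 0 ≤ j then
      ∑ᶠ m : ℤ, ((m : ℂ) ^ j.toNat / (j.toNat.factorial : ℂ)) • A m (s - m) w
    else 0

end Fields

/-- A weak quantum vertex algebra structure on the complex vector space `V`. -/
structure WeakQVA (V : Type*) [AddCommGroup V] [Module ℂ V] where
  /-- the adjoint vertex operator map `v ↦ Y(v, x)` -/
  Y : V →ₗ[ℂ] VertexOperator ℂ V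
  /-- the vacuum vector -/
  vac : V
  /-- `Y(1, x) v = v` -/
  vac_left : ∀ (v : V) (n : ℤ), coeff (Y vac) n v = if n = 0 then v else 0
  /-- `Y(v, x) 1 ∈ V[[x]]` -/
  vac_right : ∀ (v : V) (n : ℤ), n < 0 → coeff (Y v) n vac = 0
  /-- the constant term of `Y(v, x) 1` is `v` -/
  vac_right_zero : ∀ v : V, coeff (Y v) 0 vac = v
  /-- the `𝓢`-Jacobi identity (applied to `w`) -/
  jacobi : ∀ u v : V, ∃ (r : ℕ) (u' v' : Fin r → V) (f : Fin r → LaurentSeries ℂ), ∀ w : V,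
    mul3 delta1 (inX1X2 (applyTo (prod12 (Y u) (Y v)) w))
      - mul3 delta2 (inX1X2 (∑ i, mul2 (evalX2SubX1 (f i))
          (applyTo (prod21 (Y (v' i)) (Y (u' i))) w)))
      = mul3 delta3 (inX0X2 fun l n => coeff (Y (coeff (Y u) l v)) n w)

namespace WeakQVA

variable {V : Type*} [AddCommGroup V] [Module ℂ V]

/-- `uₙ v`, where `Y(u, x) v = ∑ uₙ v x^{-n-1}`. -/
def nprod (𝒱 : WeakQVA V) (u : V) (n : ℤ) (v : V) : V := VertexOperator.ncoeff (𝒱.Y u) n v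

/-- `V` is of T-type: for all `u, v` there are `u⁽ⁱ⁾, v⁽ⁱ⁾ ∈ V`, rational functions `fᵢ` and
`k ∈ ℕ` with `(x₁ - x₂)ᵏ Y(u, x₁) Y(v, x₂)
  = (x₁ - x₂)ᵏ ∑ᵢ ι_{x₂,x₁}(fᵢ(e^{x₁ - x₂})) Y(v⁽ⁱ⁾, x₂) Y(u⁽ⁱ⁾, x₁)`. -/
def IsTType (𝒱 : WeakQVA V) : Prop :=
  ∀ u v : V, ∃ (k : ℕ) (r : ℕ) (u' v' : Fin r → V) (f : Fin r → RatFunc ℂ), ∀ w : V,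
    mul2 (subPow12 k) (applyTo (prod12 (𝒱.Y u) (𝒱.Y v)) w)
      = mul2 (subPow12 k) (∑ i, mul2 (evalX1SubX2 (ratExp (f i)))
          (applyTo (prod21 (𝒱.Y (v' i)) (𝒱.Y (u' i))) w))

/-- The group of automorphisms of a weak quantum vertex algebra: the bijective linear `σ` with
`σ(1) = 1` and `σ(Y(u, x) v) = Y(σ(u), x) σ(v)`. -/
def Aut (𝒱 : WeakQVA V) : Subgroup (V ≃ₗ[ℂ] V) where
  carrier := {σ | σ 𝒱.vac = 𝒱.vac ∧
    ∀ (u v : V) (n : ℤ), σ (coeff (𝒱.Y u) n v) = coeff (𝒱.Y (σ u)) n (σ v)}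
  one_mem' := ⟨rfl, fun _ _ _ => rfl⟩
  mul_mem' := by
    rintro σ τ ⟨h1, h2⟩ ⟨h3, h4⟩
    refine ⟨?_, fun u v n => ?_⟩
    · rw [LinearEquiv.mul_apply, h3, h1]
    · rw [LinearEquiv.mul_apply, LinearEquiv.mul_apply, LinearEquiv.mul_apply, h4, h2]
  inv_mem' := by
    rintro σ ⟨h1, h2⟩
    have hs : ∀ x, σ (σ⁻¹ x) = x := fun x => σ.apply_symm_apply x
    refine ⟨σ.injective ?_, fun u v n => σ.injective ?_⟩
    · rw [hs, h1]
    · rw [hs, h2, hs, hs]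

/-- `k` is the pole order of `Y(u, x) v`, and it is positive: `k ≥ 1`, `u_{k-1} v ≠ 0`, and
`uₙ v = 0` for all `n ≥ k`. -/
def HasPosTruncOrder (𝒱 : WeakQVA V) (u v : V) (k : ℕ) : Prop :=
  1 ≤ k ∧ 𝒱.nprod u ((k : ℤ) - 1) v ≠ 0 ∧ ∀ n : ℤ, (k : ℤ) ≤ n → 𝒱.nprod u n v = 0

end WeakQVA

/-- A `φ`-coordinated quasi `V`-module structure on `W`, for `φ(x, z) = x eᶻ`. -/
structure PhiQuasiModule {V : Type*} [AddCommGroup V] [Module ℂ V] (𝒱 : WeakQVA V)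
    (W : Type*) [AddCommGroup W] [Module ℂ W] where
  /-- the map `v ↦ Y_W(v, x)` -/
  YW : V →ₗ[ℂ] VertexOperator ℂ W
  /-- `Y_W(1, x) = 1_W` -/
  vac_left : ∀ (w : W) (n : ℤ), coeff (YW 𝒱.vac) n w = if n = 0 then w else 0
  /-- for a nonzero polynomial `p`, `p(x₁/x₂) Y_W(u, x₁) Y_W(v, x₂) ∈ Hom(W, W((x₁, x₂)))` and
  `p(eᶻ) Y_W(Y(u, z) v, x₂) = (p(x₁/x₂) Y_W(u, x₁) Y_W(v, x₂))|_{x₁ = x₂ eᶻ}`; the two sides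
  of the latter are compared at `zʲ x₂ˢ` -/
  assoc : ∀ u v : V, ∃ p : Polynomial ℂ, p ≠ 0 ∧
    InHomLaurent2 (mulRatio p (prod12 (YW u) (YW v))) ∧
    ∀ (w : W) (j s : ℤ),
      ∑ᶠ i : ℕ, PowerSeries.coeff i (polyExp p) •
          coeff (YW (coeff (𝒱.Y u) (j - i) v)) s w
        = substExp (mulRatio p (prod12 (YW u) (YW v))) w j s

/-- `G`-covariance of a `φ`-coordinated quasi module, for a group `G` acting on `V` by
automorphisms through `ρ` and a linear character `χ : G → ℂˣ`. -/
structure PhiQuasiModule.IsCovariant {V : Type*} [AddCommGroup V] [Module ℂ V]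
    {𝒱 : WeakQVA V} {W : Type*} [AddCommGroup W] [Module ℂ W] (M : PhiQuasiModule 𝒱 W)
    {G : Type*} [Group G] (ρ : G →* 𝒱.Aut) (χ : G →* ℂˣ) : Prop where
  /-- `Y_W(g v, x) = Y_W(v, χ(g) x)` -/
  covariant : ∀ (g : G) (v : V) (n : ℤ),
    coeff (M.YW ((ρ g : V ≃ₗ[ℂ] V) v)) n = ((χ g : ℂ) ^ n) • coeff (M.YW v) n
  /-- `p(x₁/x₂) Y_W(u, x₁) Y_W(v, x₂) ∈ Hom(W, W((x₁, x₂)))` for a (nonzero) polynomial `p` all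
  of whose zeros are in `χ(G)` -/
  quasi : ∀ u v : V, ∃ p : Polynomial ℂ, p ≠ 0 ∧
    (∀ z : ℂ, p.IsRoot z → ∃ g : G, (χ g : ℂ) = z) ∧
    InHomLaurent2 (mulRatio p (prod12 (M.YW u) (M.YW v)))

end QVA

end

noncomputable section

/-! The polynomials clearing the poles of `Y_W(u, x₁) Y_W(v, x₂)` form an ideal of `ℂ[X]`
(`regularizers`), generated by one polynomial `p`. By covariance `p` is nonzero with all its zeros
in `χ(G)`, and `Λ` is its set of zeros. It remains to bound the multiplicity of a zero `χ(σ)` of `p`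
by the pole order of `Y(σu, z)v`; then `p` divides the product over `S`.

Covariance turns `u` into `σu` by rescaling `x₁`, which moves the zero to `1`. Suppose `(X - 1)r`
clears the poles, `(X - 1)^N ∣ r`, and `z^N Y(u, z)v` is regular. Under `x₁ = x₂eᶻ`, associativity
makes `(X - 1)r` times the product divisible by `z`, so it vanishes at `x₁ = x₂` and `r` already
clears the poles (`mem_regularizers_of_X_sub_one_mul`). Minimality of `p` forbids this when `(X -
1)r = p`. -/

namespace QVA

open Polynomial

/-! ### Multiplication by polynomials in `x₁/x₂`. -/

section Ratio

variable {M : Type*} [AddCommGroup M] [Module ℂ M]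

/-- Multiplication by `x₁/x₂`. -/
def shiftRatio : Module.End ℂ (Series2 M) where
  toFun A := fun m n => A (m - 1) (n + 1)
  map_add' _ _ := rfl
  map_smul' _ _ := rfl

lemma shiftRatio_pow_apply (k : ℕ) (A : Series2 M) (m n : ℤ) :
    (shiftRatio ^ k) A m n = A (m - k) (n + k) := by
  induction k generalizing m n with
  | zero => simp
  | succ k ih =>
    rw [pow_succ', Module.End.mul_apply]
    change (shiftRatio ^ k) A (m - 1) (n + 1) = _
    rw [ih]
    congr 1 <;> push_cast <;> ring

lemma mulRatio_eq_aeval (p : ℂ[X]) (A : Series2 M) :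
    mulRatio p A = aeval (shiftRatio (M := M)) p A := by
  funext m n
  simp only [mulRatio, aeval_def, eval₂_eq_sum, Polynomial.sum, LinearMap.sum_apply,
    Finset.sum_apply]
  refine Finset.sum_congr rfl fun k _ => ?_
  rw [Module.End.mul_apply, Module.algebraMap_end_apply, Pi.smul_apply, Pi.smul_apply,
    shiftRatio_pow_apply]

lemma mulRatio_mul (p q : ℂ[X]) (A : Series2 M) :
    mulRatio (p * q) A = mulRatio p (mulRatio q A) := by
  simp only [mulRatio_eq_aeval, map_mul, Module.End.mul_apply]

lemma mulRatio_add (p q : ℂ[X]) (A : Series2 M) :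
    mulRatio (p + q) A = mulRatio p A + mulRatio q A := by
  simp only [mulRatio_eq_aeval, map_add, LinearMap.add_apply]

lemma mulRatio_zero (A : Series2 M) : mulRatio 0 A = 0 := by
  simp only [mulRatio_eq_aeval, map_zero, LinearMap.zero_apply]

lemma mulRatio_monomial (k : ℕ) (c : ℂ) (A : Series2 M) (m n : ℤ) :
    mulRatio (monomial k c) A m n = c • A (m - k) (n + k) := by
  simp [mulRatio, sum_monomial_index]

lemma mulRatio_X_sub_one (A : Series2 M) (m n : ℤ) :
    mulRatio (X - 1 : ℂ[X]) A m n = A (m - 1) (n + 1) - A m n := by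
  rw [mulRatio_eq_aeval, map_sub, aeval_X, map_one]
  rfl

/-- Substituting `cx₁` for `x₁` commutes with the product; a zero of `p` at `c` becomes a zero at
`1`. -/
lemma mulRatio_comp_C_mul_X (p : ℂ[X]) {c : ℂ} (hc : c ≠ 0) (A : Series2 M) :
    mulRatio (p.comp (C c * X)) (fun m n => c ^ m • A m n)
      = fun m n => c ^ m • mulRatio p A m n := by
  induction p using Polynomial.induction_on' with
  | add p q hp hq =>
    rw [add_comp, mulRatio_add, hp, hq, mulRatio_add]
    funext m n
    simp only [Pi.add_apply, smul_add]
  | monomial k a =>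
    funext m n
    rw [monomial_comp, mul_pow, ← C_pow, ← mul_assoc, ← C_mul, C_mul_X_pow_eq_monomial,
      mulRatio_monomial, mulRatio_monomial, smul_smul, smul_smul, mul_assoc, mul_comm (c ^ m) a,
      ← zpow_natCast, ← zpow_add₀ hc, add_sub_cancel]

end Ratio

/-! ### The ideal of pole-clearing polynomials, and cancelling a factor `x₁/x₂ - 1`. -/

section HomLaurent

variable {W : Type*} [AddCommGroup W] [Module ℂ W]

lemma InHomLaurent2.zero : InHomLaurent2 (0 : Series2 (Module.End ℂ W)) :=
  fun _ => ⟨0, fun _ _ h => absurd rfl h⟩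

lemma InHomLaurent2.add {A B : Series2 (Module.End ℂ W)} (hA : InHomLaurent2 A)
    (hB : InHomLaurent2 B) : InHomLaurent2 (A + B) := by
  intro w
  obtain ⟨N, hN⟩ := hA w
  obtain ⟨K, hK⟩ := hB w
  refine ⟨min N K, fun m n h => ?_⟩
  by_cases hAw : A m n w = 0
  · have hBw : B m n w ≠ 0 := fun hBw => h (by simp [hAw, hBw])
    have := hK m n hBw
    omega
  · have := hN m n hAw
    omega

lemma InHomLaurent2.mulRatio {A : Series2 (Module.End ℂ W)} (hA : InHomLaurent2 A) (p : ℂ[X]) :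
    InHomLaurent2 (mulRatio p A) := by
  induction p using Polynomial.induction_on' with
  | add p q hp hq =>
    rw [mulRatio_add]
    exact hp.add hq
  | monomial k a =>
    intro w
    obtain ⟨N, hN⟩ := hA w
    refine ⟨N - k, fun m n h => ?_⟩
    rw [mulRatio_monomial, LinearMap.smul_apply] at h
    have := hN _ _ (right_ne_zero_of_smul h)
    omega

/-- The ideal of the polynomials `p` with `p(x₁/x₂) A(x₁, x₂) ∈ Hom(W, W((x₁, x₂)))`. -/
def regularizers (A : Series2 (Module.End ℂ W)) : Ideal ℂ[X] where
  carrier := {p | InHomLaurent2 (QVA.mulRatio p A)}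
  zero_mem' := by
    change InHomLaurent2 _
    rw [mulRatio_zero]
    exact InHomLaurent2.zero
  add_mem' hp hq := by
    change InHomLaurent2 _
    rw [mulRatio_add]
    exact InHomLaurent2.add hp hq
  smul_mem' q p hp := by
    change InHomLaurent2 _
    rw [smul_eq_mul, mulRatio_mul]
    exact InHomLaurent2.mulRatio hp q

lemma mem_regularizers {A : Series2 (Module.End ℂ W)} {p : ℂ[X]} :
    p ∈ regularizers A ↔ InHomLaurent2 (QVA.mulRatio p A) := Iff.rfl

lemma comp_mem_regularizers {A B : Series2 (Module.End ℂ W)} {c : ℂ} (hc : c ≠ 0)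
    (hB : ∀ m n, B m n = c ^ m • A m n) (p : ℂ[X]) :
    p.comp (C c * X) ∈ regularizers B ↔ p ∈ regularizers A := by
  obtain rfl : B = fun m n => c ^ m • A m n := by funext m n; exact hB m n
  rw [mem_regularizers, mulRatio_comp_C_mul_X p hc, mem_regularizers]
  simp only [InHomLaurent2, LinearMap.smul_apply, ne_eq, smul_eq_zero, zpow_ne_zero _ hc,
    false_or]

/-- If `(x₁/x₂ - 1) A(x₁, x₂)` has no poles other than at `x₁ = 0` and `x₂ = 0`, and vanishes at
`x₁ = x₂`, then `A(x₁, x₂)` has no poles other than these either. -/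
lemma InHomLaurent2.of_mulRatio_X_sub_one {A : Series2 (Module.End ℂ W)}
    (hA : ∀ w, ∃ K : ℤ, ∀ m n, n < K → A m n w = 0)
    (hF : InHomLaurent2 (QVA.mulRatio (X - 1 : ℂ[X]) A))
    (h0 : ∀ w s, ∑ᶠ m : ℤ, QVA.mulRatio (X - 1 : ℂ[X]) A m (s - m) w = 0) :
    InHomLaurent2 A := by
  intro w
  obtain ⟨K, hK⟩ := hA w
  obtain ⟨N, hN⟩ := hF w
  refine ⟨N, fun m n h => ?_⟩
  -- On the diagonal of total degree `m + n`, multiplication by `x₁/x₂ - 1` is a difference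
  -- operator, so its partial sums recover `A`.
  have key : ∀ i : ℤ, QVA.mulRatio (X - 1 : ℂ[X]) A i (m + n - i) w
      = A (i - 1) (m + n - (i - 1)) w - A i (m + n - i) w := by
    intro i
    rw [mulRatio_X_sub_one, LinearMap.sub_apply]
    rw [show m + n - i + 1 = m + n - (i - 1) by ring]
  have tele : ∀ t : ℕ, ∑ i ∈ Finset.range t,
      QVA.mulRatio (X - 1 : ℂ[X]) A (m + 1 + i) (m + n - (m + 1 + i)) w
        = A m n w - A (m + t) (m + n - (m + t)) w := by
    intro t
    induction t with
    | zero => simp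
    | succ t ih =>
      rw [Finset.sum_range_succ, ih, key]
      rw [show m + 1 + (t : ℤ) - 1 = m + t by ring, show m + 1 + (t : ℤ) = m + (t + 1 : ℕ) by
        push_cast; ring]
      abel
  -- The second index is below `K`; if `n < K` the truncation to `0` leaves `A m n` itself.
  have htail : A (m + (n - K + 1).toNat) (m + n - (m + (n - K + 1).toNat)) w = 0 :=
    hK _ _ (by omega)
  have hsum := tele (n - K + 1).toNat
  rw [htail, sub_zero] at hsum
  constructor
  -- For `m < N` the partial sum contains the whole support on the diagonal, so it equals the
  -- vanishing full sum.
  · by_contra! hm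
    refine h (hsum.symm.trans ?_)
    rw [← h0 w (m + n), finsum_eq_sum_of_support_subset (s := (Finset.range
      (n - K + 1).toNat).map ⟨fun i : ℕ => m + 1 + (i : ℤ), fun i j hij => by simpa using hij⟩)]
    · rw [Finset.sum_map]
      rfl
    · intro i hi
      have h1 := hN _ _ hi
      have h2 : i ≤ m + n - K + 1 := by
        by_contra! hlt
        refine hi ?_
        change QVA.mulRatio (X - 1 : ℂ[X]) A i (m + n - i) w = 0
        rw [key, hK _ _ (by omega), hK _ _ (by omega), sub_zero]
      simp only [Finset.coe_map, Set.mem_image, Finset.mem_coe, Finset.mem_range]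
      exact ⟨(i - m - 1).toNat, by omega, show m + 1 + ((i - m - 1).toNat : ℤ) = i by omega⟩
  -- For `n < N` every second index in the sum is below `N`, so each term vanishes.
  · by_contra! hn
    refine h (hsum.symm.trans (Finset.sum_eq_zero fun i _ => ?_))
    by_contra hne
    have := hN _ _ hne
    omega

end HomLaurent

/-! ### The substitution `X ↦ eᶻ` in polynomials. -/

lemma polyExp_mul (p q : ℂ[X]) : polyExp (p * q) = polyExp p * polyExp q :=
  map_mul _ p q

lemma polyExp_add (p q : ℂ[X]) : polyExp (p + q) = polyExp p + polyExp q :=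
  map_add _ p q

lemma polyExp_monomial (k : ℕ) (c : ℂ) :
    polyExp (monomial k c) = c • PowerSeries.rescale (k : ℂ) (PowerSeries.exp ℂ) := by
  rw [polyExp, aeval_monomial, PowerSeries.exp_pow_eq_rescale_exp, Algebra.smul_def]

lemma polyExp_X_sub_one : polyExp (X - 1) = PowerSeries.exp ℂ - 1 := by
  simp [polyExp]

lemma X_dvd_polyExp_X_sub_one : (PowerSeries.X : PowerSeries ℂ) ∣ polyExp (X - 1) := by
  rw [PowerSeries.X_dvd_iff, polyExp_X_sub_one, map_sub, PowerSeries.constantCoeff_exp, map_one,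
    sub_self]

lemma constantCoeff_polyExp (p : ℂ[X]) : PowerSeries.constantCoeff (polyExp p) = p.eval 1 := by
  induction p using Polynomial.induction_on' with
  | add p q hp hq => rw [polyExp_add, map_add, hp, hq, eval_add]
  | monomial k a =>
    rw [polyExp, aeval_monomial, map_mul, map_pow, PowerSeries.constantCoeff_exp, eval_monomial]
    simp

/-- Split off the powers of `X - 1`: `eᶻ - 1` has linear coefficient `1`, and the cofactor has
nonzero constant term, its value at `1`. -/
lemma polyExp_ne_zero {p : ℂ[X]} (hp : p ≠ 0) : polyExp p ≠ 0 := by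
  obtain ⟨q, hq, hdvd⟩ := exists_eq_pow_rootMultiplicity_mul_and_not_dvd p hp 1
  have hX : polyExp (X - 1) ≠ 0 := by
    intro h
    have := congrArg (PowerSeries.coeff 1) h
    rw [polyExp_X_sub_one, map_sub, PowerSeries.coeff_exp] at this
    simp [PowerSeries.coeff_one] at this
  have hq1 : polyExp q ≠ 0 := by
    intro h
    refine hdvd (dvd_iff_isRoot.mpr ?_)
    rw [IsRoot, ← constantCoeff_polyExp, h, map_zero]
  rw [hq, polyExp_mul, show polyExp ((X - C 1) ^ rootMultiplicity 1 p)
    = polyExp (X - 1) ^ rootMultiplicity 1 p by rw [map_one]; exact map_pow _ _ _]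
  exact mul_ne_zero (pow_ne_zero _ hX) hq1

/-! ### The substitution `x₁ = x₂eᶻ`, tested against functionals so as to compute in the domain
`ℂ[[z]]`. -/

section ExpDiag

variable {W : Type*} [AddCommGroup W] [Module ℂ W]

/-- The coefficient of `x₂ˢ` in `φ(A(x₁, x₂) w)|_{x₁ = x₂ eᶻ}`, as a power series in `z`. -/
def expDiag (φ : Module.Dual ℂ W) (A : Series2 (Module.End ℂ W)) (w : W) (s : ℤ) :
    PowerSeries ℂ :=
  ∑ᶠ m : ℤ, φ (A m (s - m) w) • PowerSeries.rescale (m : ℂ) (PowerSeries.exp ℂ)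

lemma InHomLaurent2.finite_diag {A : Series2 (Module.End ℂ W)} (hA : InHomLaurent2 A) (w : W)
    (s : ℤ) : {m : ℤ | A m (s - m) w ≠ 0}.Finite := by
  obtain ⟨N, hN⟩ := hA w
  refine (Set.finite_Icc N (s - N)).subset fun m hm => ?_
  have := hN _ _ hm
  rw [Set.mem_Icc]
  omega

lemma InHomLaurent2.finite_support_expDiag {A : Series2 (Module.End ℂ W)} (hA : InHomLaurent2 A)
    (φ : Module.Dual ℂ W) (w : W) (s : ℤ) :
    (Function.support fun m : ℤ => φ (A m (s - m) w) •
      PowerSeries.rescale (m : ℂ) (PowerSeries.exp ℂ)).Finite :=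
  (hA.finite_diag w s).subset fun m hm h => hm (by
    change φ (A m (s - m) w) • _ = _
    rw [h, map_zero, zero_smul])

lemma coeff_expDiag {A : Series2 (Module.End ℂ W)} (hA : InHomLaurent2 A)
    (φ : Module.Dual ℂ W) (w : W) (s : ℤ) (j : ℕ) :
    PowerSeries.coeff j (expDiag φ A w s) = φ (substExp A w j s) := by
  rw [substExp, if_pos (by positivity), expDiag, map_finsum _ (hA.finite_support_expDiag φ w s),
    map_finsum φ ((hA.finite_diag w s).subset fun m hm h => hm (by
      rw [h, smul_zero]))]
  refine finsum_congr fun m => ?_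
  rw [PowerSeries.coeff_smul, PowerSeries.coeff_rescale, PowerSeries.coeff_exp, map_smul,
    smul_eq_mul, smul_eq_mul, Int.toNat_natCast, mul_comm]
  simp [div_eq_mul_inv]

lemma expDiag_mulRatio {A : Series2 (Module.End ℂ W)} (hA : InHomLaurent2 A)
    (φ : Module.Dual ℂ W) (w : W) (s : ℤ) (p : ℂ[X]) :
    expDiag φ (mulRatio p A) w s = polyExp p * expDiag φ A w s := by
  induction p using Polynomial.induction_on' with
  | add p q hp hq =>
    rw [polyExp_add, add_mul, ← hp, ← hq, expDiag, expDiag, expDiag, ← finsum_add_distrib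
      ((hA.mulRatio p).finite_support_expDiag φ w s) ((hA.mulRatio q).finite_support_expDiag φ w s)]
    refine finsum_congr fun m => ?_
    rw [mulRatio_add, ← add_smul, ← map_add]
    rfl
  | monomial k a =>
    rw [polyExp_monomial, expDiag, expDiag, mul_finsum' _ _ (hA.finite_support_expDiag φ w s),
      ← finsum_comp_equiv (Equiv.addRight (k : ℤ))]
    refine finsum_congr fun m => ?_
    rw [mulRatio_monomial, Equiv.coe_addRight, add_sub_cancel_right, LinearMap.smul_apply,
      map_smul, smul_mul_smul_comm, PowerSeries.exp_mul_exp_eq_exp_add, smul_eq_mul,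
      show s - (m + k) + k = s - m by ring]
    push_cast
    rw [add_comm]

end ExpDiag

lemma exists_forall_lt_coeff_eq_zero {V : Type*} [AddCommGroup V] [Module ℂ V]
    (A : VertexOperator ℂ V) (v : V) :
    ∃ K : ℤ, ∀ n < K, HVertexOperator.coeff A n v = 0 :=
  ⟨_, fun n hn => VertexOperator.coeff_eq_zero_of_lt_order A n v hn⟩

/-! ### Associativity and the pole at `x₁ = x₂`. -/

namespace PhiQuasiModule

variable {V : Type*} [AddCommGroup V] [Module ℂ V] {𝒱 : WeakQVA V}
  {W : Type*} [AddCommGroup W] [Module ℂ W] (M : PhiQuasiModule 𝒱 W)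

/-- `φ(z^N Y_W(Y(u, z) v, x₂) w)` at `x₂ˢ`, a power series in `z` if `z^N Y(u, z) v` is one. -/
def iterateSeries (φ : Module.Dual ℂ W) (u v : V) (N : ℕ) (w : W) (s : ℤ) : PowerSeries ℂ :=
  PowerSeries.mk fun l =>
    φ (HVertexOperator.coeff (M.YW (HVertexOperator.coeff (𝒱.Y u) (l - N) v)) s w)

/-- The associativity relation of a quasi module holds for every polynomial `p` for which
`p(x₁/x₂) Y_W(u, x₁) Y_W(v, x₂)` lies in `Hom(W, W((x₁, x₂)))`. -/
lemma polyExp_mul_iterateSeries (φ : Module.Dual ℂ W) (u v : V) (N : ℕ)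
    (hN : ∀ l : ℤ, l < -N → HVertexOperator.coeff (𝒱.Y u) l v = 0) (w : W) (s : ℤ)
    {p : ℂ[X]} (hp : p ∈ regularizers (prod12 (M.YW u) (M.YW v))) :
    polyExp p * M.iterateSeries φ u v N w s
      = PowerSeries.X ^ N * expDiag φ (mulRatio p (prod12 (M.YW u) (M.YW v))) w s := by
  obtain ⟨q, hq0, hq, hassoc⟩ := M.assoc u v
  have hqe : polyExp q * M.iterateSeries φ u v N w s
      = PowerSeries.X ^ N * expDiag φ (mulRatio q (prod12 (M.YW u) (M.YW v))) w s := by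
    ext l
    have hl := congrArg φ (hassoc w (l - N) s)
    have hsupp : (Function.support fun i : ℕ => PowerSeries.coeff i (polyExp q) •
        HVertexOperator.coeff (M.YW (HVertexOperator.coeff (𝒱.Y u) ((l : ℤ) - N - i) v)) s w)
          ⊆ (Finset.range (l + 1) : Set ℕ) := by
      intro i hi
      rw [Finset.mem_coe, Finset.mem_range]
      by_contra hlt
      refine hi ?_
      change _ • HVertexOperator.coeff (M.YW (HVertexOperator.coeff (𝒱.Y u) _ v)) s w = 0
      rw [hN _ (by omega)]
      simp
    rw [finsum_eq_sum_of_support_subset _ hsupp, map_sum] at hl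
    rw [PowerSeries.coeff_mul, Finset.Nat.sum_antidiagonal_eq_sum_range_succ_mk,
      PowerSeries.coeff_X_pow_mul']
    trans φ (substExp (mulRatio q (prod12 (M.YW u) (M.YW v))) w (l - N) s)
    · rw [← hl]
      refine Finset.sum_congr rfl fun i hi => ?_
      rw [Finset.mem_range] at hi
      rw [iterateSeries, PowerSeries.coeff_mk, map_smul, smul_eq_mul,
        show ((l - i : ℕ) : ℤ) - N = (l : ℤ) - N - i by omega]
    · split_ifs with h
      · rw [coeff_expDiag hq, Nat.cast_sub h]
      · rw [substExp, if_neg (by omega), map_zero]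
  -- Associativity is given for one `q` only; both sides are compared after multiplying by `q(eᶻ)`,
  -- through the common multiple `pq`.
  refine mul_left_cancel₀ (polyExp_ne_zero hq0) ?_
  rw [mul_left_comm, hqe, mul_left_comm (polyExp p), mul_left_comm (polyExp q),
    ← expDiag_mulRatio hq, ← expDiag_mulRatio hp, ← mulRatio_mul, ← mulRatio_mul, mul_comm p q]

/-- `(eᶻ - 1)^(N+1)` supplies `N + 1` factors `z`, of which the pole of `Y(u, z)v` uses at most `N`;
the one left gives vanishing at `x₁ = x₂`. -/
lemma mem_regularizers_of_X_sub_one_mul (u v : V) (N : ℕ)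
    (hN : ∀ l : ℤ, l < -N → HVertexOperator.coeff (𝒱.Y u) l v = 0) {r : ℂ[X]}
    (hr : (X - 1) ^ N ∣ r)
    (h : (X - 1) * r ∈ regularizers (prod12 (M.YW u) (M.YW v))) :
    r ∈ regularizers (prod12 (M.YW u) (M.YW v)) := by
  have hF : InHomLaurent2 _ := h
  rw [mulRatio_mul] at hF
  refine InHomLaurent2.of_mulRatio_X_sub_one (fun w => ?_) hF fun w s => ?_
  · obtain ⟨K, hK⟩ := exists_forall_lt_coeff_eq_zero (M.YW v) w
    have hnat : (r.natDegree : ℤ) ≥ 0 := by positivity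
    -- Multiplication by `r(x₁/x₂)` lowers exponents of `x₂` by at most `deg r`.
    refine ⟨K - r.natDegree, fun m n hn => ?_⟩
    rw [mulRatio, Polynomial.sum, LinearMap.sum_apply]
    refine Finset.sum_eq_zero fun k hk => ?_
    have hk := le_natDegree_of_mem_supp k hk
    rw [LinearMap.smul_apply, prod12, LinearMap.comp_apply, hK _ (by omega), map_zero, smul_zero]
  · have hz : ∀ w s, substExp (mulRatio (X - 1) (mulRatio r (prod12 (M.YW u) (M.YW v)))) w 0 s
        = 0 := by
      intro w s
      rw [← Module.forall_dual_apply_eq_zero_iff ℂ]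
      intro φ
      have hmul := M.polyExp_mul_iterateSeries φ u v N hN w s h
      obtain ⟨t, rfl⟩ := hr
      obtain ⟨y, hy⟩ := X_dvd_polyExp_X_sub_one
      rw [← mul_assoc, ← pow_succ', polyExp_mul,
        show polyExp ((X - 1) ^ (N + 1)) = polyExp (X - 1) ^ (N + 1) from map_pow _ _ _, hy,
        mul_pow, pow_succ PowerSeries.X, mul_assoc, mul_assoc, mul_assoc] at hmul
      have hX := mul_left_cancel₀ (pow_ne_zero N PowerSeries.X_ne_zero) hmul
      rw [← mulRatio_mul, ← mul_assoc, ← pow_succ', ← Nat.cast_zero, ← coeff_expDiag (by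
        rwa [← mulRatio_mul, ← mul_assoc, ← pow_succ'] at hF), ← hX]
      simp
    have := hz w s
    -- At `z⁰` every weight `m⁰/0!` is `1`, also for `m = 0`, leaving the plain diagonal sum.
    rw [substExp, if_pos le_rfl] at this
    simpa using this

end PhiQuasiModule

lemma WeakQVA.exists_hasPosTruncOrder {V : Type*} [AddCommGroup V] [Module ℂ V] (𝒱 : WeakQVA V)
    {u v : V} {n : ℕ} (h : 𝒱.nprod u n v ≠ 0) : ∃ k : ℕ, 𝒱.HasPosTruncOrder u v k := by
  classical
  obtain ⟨K, hK⟩ := exists_forall_lt_coeff_eq_zero (𝒱.Y u) v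
  have hex : ∃ k : ℕ, ∀ i : ℤ, (k : ℤ) ≤ i → 𝒱.nprod u i v = 0 :=
    ⟨(-K).toNat, fun i hi => hK _ (by omega)⟩
  have hpos : 1 ≤ Nat.find hex := by
    by_contra! hlt
    exact h (Nat.find_spec hex n (by omega))
  refine ⟨Nat.find hex, hpos, fun h0 => ?_, Nat.find_spec hex⟩
  refine Nat.find_min hex (Nat.sub_lt hpos Nat.one_pos) fun i hi => ?_
  rcases eq_or_ne i ((Nat.find hex : ℤ) - 1) with rfl | hne
  · exact h0
  · exact Nat.find_spec hex i (by omega)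

/-! ### Transport of zeros by covariance. -/

namespace PhiQuasiModule

variable {V : Type*} [AddCommGroup V] [Module ℂ V] {𝒱 : WeakQVA V}
  {W : Type*} [AddCommGroup W] [Module ℂ W] {M : PhiQuasiModule 𝒱 W}
  {G : Type*} [Group G] {ρ : G →* 𝒱.Aut} {χ : G →* ℂˣ}

lemma IsCovariant.mem_regularizers_of_X_sub_C_mul (hM : M.IsCovariant ρ χ) (u v : V) (σ : G)
    (N : ℕ) (hN : ∀ n : ℤ, N ≤ n → 𝒱.nprod ((ρ σ : V ≃ₗ[ℂ] V) u) n v = 0) {r : ℂ[X]}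
    (hr : (X - C (χ σ : ℂ)) ^ N ∣ r)
    (h : (X - C (χ σ : ℂ)) * r ∈ regularizers (prod12 (M.YW u) (M.YW v))) :
    r ∈ regularizers (prod12 (M.YW u) (M.YW v)) := by
  have hc : (χ σ : ℂ) ≠ 0 := (χ σ).ne_zero
  have hcov : ∀ m n, prod12 (M.YW ((ρ σ : V ≃ₗ[ℂ] V) u)) (M.YW v) m n
      = (χ σ : ℂ) ^ m • prod12 (M.YW u) (M.YW v) m n := by
    intro m n
    rw [prod12, hM.covariant, LinearMap.smul_comp]
    rfl
  have hX : (X - C (χ σ : ℂ)).comp (C (χ σ : ℂ) * X) = C (χ σ : ℂ) * (X - 1) := by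
    rw [sub_comp, X_comp, C_comp, mul_sub, mul_one]
  have hunit : IsUnit (C (χ σ : ℂ)) := isUnit_C.mpr hc.isUnit
  rw [← comp_mem_regularizers hc hcov] at h ⊢
  refine M.mem_regularizers_of_X_sub_one_mul _ v N (fun l hl => ?_) ?_ ?_
  · have := hN (-l - 1) (by omega)
    rwa [WeakQVA.nprod, VertexOperator.ncoeff_apply, show -(-l - 1) - 1 = l by ring] at this
  · obtain ⟨t, rfl⟩ := hr
    rw [mul_comp, pow_comp, hX, mul_pow, mul_assoc]
    exact dvd_mul_of_dvd_right (dvd_mul_right _ _) _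
  -- Rescaling turns `X - χ(σ)` into `χ(σ)(X - 1)`; the unit does not affect membership.
  · rw [mul_comp, hX, mul_assoc] at h
    exact (Ideal.unit_mul_mem_iff_mem _ hunit).mp h

/-- The pole order of `Y(σ u, z) v` is at least the multiplicity of `χ(σ)` in the monic polynomial
of least degree which removes the poles of `Y_W(u, x₁) Y_W(v, x₂)`. -/
lemma IsCovariant.exists_nprod_ne_zero (hM : M.IsCovariant ρ χ) (u v : V) (σ : G) {p : ℂ[X]}
    (hp0 : p ≠ 0) (hp : regularizers (prod12 (M.YW u) (M.YW v)) = Ideal.span {p})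
    {N : ℕ} (hdvd : (X - C (χ σ : ℂ)) ^ (N + 1) ∣ p) :
    ∃ n : ℕ, N ≤ n ∧ 𝒱.nprod ((ρ σ : V ≃ₗ[ℂ] V) u) n v ≠ 0 := by
  by_contra! hall
  obtain ⟨t, ht⟩ := hdvd
  rw [pow_succ', mul_assoc] at ht
  have hmem : (X - C (χ σ : ℂ)) ^ N * t ∈ regularizers (prod12 (M.YW u) (M.YW v)) := by
    refine hM.mem_regularizers_of_X_sub_C_mul u v σ N (fun n hn => ?_) (dvd_mul_right _ _) ?_
    · lift n to ℕ using by omega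
      exact hall n (by omega)
    · rw [← ht, hp]
      exact Ideal.mem_span_singleton_self p
  rw [hp, Ideal.mem_span_singleton] at hmem
  have hne : (X - C (χ σ : ℂ)) ^ N * t ≠ 0 := right_ne_zero_of_mul (ht ▸ hp0)
  have hdeg := natDegree_le_of_dvd hmem hne
  rw [ht, natDegree_mul (X_sub_C_ne_zero _) hne, natDegree_X_sub_C] at hdeg
  omega

end PhiQuasiModule

end QVA

end

theorem corollary4p19 {V : Type*} [AddCommGroup V] [Module ℂ V] (𝒱 : QVA.WeakQVA V)
    (hT : 𝒱.IsTType) {G : Type*} [Group G] (ρ : G →* 𝒱.Aut) (χ : G →* ℂˣ)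
    {W : Type*} [AddCommGroup W] [Module ℂ W] (M : QVA.PhiQuasiModule 𝒱 W)
    (hM : M.IsCovariant ρ χ) (u v : V) :
    ∃ Λ : Finset ℂˣ, (∀ c ∈ Λ, ∃ σ : G, χ σ = c) ∧
      (∀ σ : G, χ σ ∈ Λ → ∃ k : ℕ, 𝒱.HasPosTruncOrder ((ρ σ : V ≃ₗ[ℂ] V) u) v k) ∧
      ∀ (S : Finset G) (k : G → ℕ),
        (∀ σ ∈ S, 𝒱.HasPosTruncOrder ((ρ σ : V ≃ₗ[ℂ] V) u) v (k σ)) →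
        (∀ c ∈ Λ, ∃ σ ∈ S, χ σ = c) →
        QVA.InHomLaurent2 (QVA.mulRatio
          (∏ σ ∈ S, (Polynomial.X - Polynomial.C (χ σ : ℂ)) ^ k σ)
          (QVA.prod12 (M.YW u) (M.YW v))) := by
  classical
  obtain ⟨p, hp⟩ := (inferInstance :
    (QVA.regularizers (QVA.prod12 (M.YW u) (M.YW v))).IsPrincipal)
  change _ = Ideal.span {p} at hp
  obtain ⟨q, hq0, hqroot, hq⟩ := hM.quasi u v
  have hpq : p ∣ q := by
    rw [← Ideal.mem_span_singleton, ← hp]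
    exact hq
  have hp0 : p ≠ 0 := ne_zero_of_dvd_ne_zero hq0 hpq
  have hroot : ∀ z, p.IsRoot z → ∃ g : G, (χ g : ℂ) = z := fun z hz =>
    hqroot z (hz.dvd hpq)
  have hΛ : ∀ c : ℂˣ, c ∈ p.roots.toFinset.preimage Units.val Units.val_injective.injOn ↔
      p.IsRoot c := fun c => by
    rw [Finset.mem_preimage, Multiset.mem_toFinset, Polynomial.mem_roots hp0]
  -- Passing to units loses no root, since all roots of `p` lie in `χ(G)`.
  refine ⟨p.roots.toFinset.preimage Units.val Units.val_injective.injOn, fun c hc => ?_,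
    fun σ hσ => ?_, fun S k hk hS => ?_⟩
  · obtain ⟨g, hg⟩ := hroot c ((hΛ c).mp hc)
    exact ⟨g, Units.ext hg⟩
  · obtain ⟨n, -, hn⟩ := hM.exists_nprod_ne_zero u v σ hp0 hp (N := 0) (by
      rw [zero_add, pow_one]
      exact Polynomial.dvd_iff_isRoot.mpr ((hΛ _).mp hσ))
    exact 𝒱.exists_hasPosTruncOrder hn
  · rw [← QVA.mem_regularizers, hp, Ideal.mem_span_singleton]
    have hprod : (∏ σ ∈ S, (Polynomial.X - Polynomial.C (χ σ : ℂ)) ^ k σ) ≠ 0 :=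
      Finset.prod_ne_zero_iff.mpr fun σ _ => pow_ne_zero _ (Polynomial.X_sub_C_ne_zero _)
    rw [IsAlgClosed.dvd_iff_roots_le_roots hp0 hprod, Multiset.le_iff_count]
    intro z
    rw [Polynomial.count_roots, Polynomial.count_roots]
    rcases Nat.eq_zero_or_pos (p.rootMultiplicity z) with h0 | hpos
    · rw [h0]
      exact Nat.zero_le _
    · have hz : p.IsRoot z := (Polynomial.rootMultiplicity_pos hp0).mp hpos
      obtain ⟨g, rfl⟩ := hroot z hz
      obtain ⟨σ, hσS, hσ⟩ := hS (χ g) ((hΛ _).mpr hz)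
      rw [← hσ] at hpos ⊢
      -- A nonzero product at some `n ≥ mult - 1` forces `k σ > n`, hence `k σ ≥ mult`.
      obtain ⟨n, hn, hne⟩ := hM.exists_nprod_ne_zero u v σ hp0 hp
        (N := p.rootMultiplicity (χ σ : ℂ) - 1) (by
          rw [Nat.sub_add_cancel hpos]
          exact Polynomial.pow_rootMultiplicity_dvd p _)
      have hlt : n < k σ := by
        by_contra! hle
        exact hne ((hk σ hσS).2.2 n (by exact_mod_cast hle))
      refine le_trans (by omega : p.rootMultiplicity (χ σ : ℂ) ≤ k σ) ?_
      rw [Polynomial.le_rootMultiplicity_iff hprod]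
      exact Finset.dvd_prod_of_mem _ hσS
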